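/- Let $(X,\rho)$ be a complete separable metric space satisfying the strict triangle inequality $$\rho(x,y)<\rho(x,z)+\rho(z,y)\qquad (x,y,z\in X,\ z\notin\{x,y\}).$$ Let $\mathcal W_1(X)$ be the set of Borel probability measures $\mu$ on $X$ with $\int_X\rho(x,\hat x)\,\mathrm d\mu(x)<\infty$ for some (hence all) $\hat x\in X$, endowed with the $1$-Wasserstein distance $$d_{\mathcal W_1}(\mu,\nu)=\inf_{\pi\in\Pi(\mu,\nu)}\int_{X\times X}\rho(x,y)\,\mathrm d\pi(x,y),$$ where $\Pi(\mu,\nu)$ is the set of Borel probability measures on $X\times X$ with marginals $\mu$ and $\nu$. Then $\mathcal W_1(X)$ is isometrically rigid: for every isometry (that is, distance preserving bijection) $\Phi\colon\mathcal W_1(X)\to\mathcal W_1(X)$ there exists an isometry (distance preserving bijection) $\psi\colon X\to X$ such that $$\Phi(\mu)=\psi_\#\mu\qquad\text{for all }\mu\in\mathcal W_1(X),$$ where $(\psi_\#\mu)(A)=\mu(\psi^{-1}[A])$ for every Borel set $A\subseteq X$. -/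

import Mathlib

open MeasureTheory
open scoped ENNReal

/-- The strict triangle inequality: `ρ(x,y) < ρ(x,z) + ρ(z,y)` whenever `z ∉ {x, y}`. -/
def StrictTriangleInequality (X : Type*) [MetricSpace X] : Prop :=
  ∀ x y z : X, z ≠ x → z ≠ y → dist x y < dist x z + dist z y

/-- The set `Π(μ,ν)` of couplings of `μ` and `ν`: measures on `X × X` with marginals `μ`, `ν`.
(If `μ` is a probability measure, then so is every coupling. For a separable metric space the
product σ-algebra on `X × X` is the Borel σ-algebra.) -/
def couplings {X : Type*} [MeasurableSpace X] (μ ν : Measure X) : Set (Measure (X × X)) :=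
  {π | π.map Prod.fst = μ ∧ π.map Prod.snd = ν}

/-- The optimal transport cost `inf_{π ∈ Π(μ,ν)} ∫ ρ(x,y) dπ(x,y)`, with values in `[0,∞]`. -/
noncomputable def transportCost {X : Type*} [MetricSpace X] [MeasurableSpace X]
    (μ ν : Measure X) : ℝ≥0∞ :=
  ⨅ π ∈ couplings μ ν, ∫⁻ z, edist z.1 z.2 ∂π

/-- The underlying set of the `1`-Wasserstein space: (Borel) probability measures on `X` with
finite first moment. -/
def WassersteinOne (X : Type*) [MetricSpace X] [MeasurableSpace X] : Type _ :=
  {μ : Measure X // IsProbabilityMeasure μ ∧ ∃ x₀ : X, ∫⁻ x, edist x x₀ ∂μ < ∞}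

/-- The measure underlying a point of the `1`-Wasserstein space. -/
def WassersteinOne.toMeasure {X : Type*} [MetricSpace X] [MeasurableSpace X]
    (μ : WassersteinOne X) : Measure X :=
  μ.1

/-- The `1`-Wasserstein distance. The transport cost between measures with finite first moment is
finite (the product measure is a coupling of finite cost), so `toReal` loses nothing. -/
noncomputable instance WassersteinOne.instDist {X : Type*} [MetricSpace X] [MeasurableSpace X] :
    Dist (WassersteinOne X) where
  dist μ ν := (transportCost μ.toMeasure ν.toMeasure).toReal

open scoped Topology
open ProbabilityTheory Filter

/-! The metric alone singles out the Dirac masses: they are the measures never strictly between two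
others (`WassersteinOne.IsEndpoint`). A non-Dirac measure lies between its conditionals on a set and
on the complement. If a Dirac mass lay between two measures, their product coupling would give
equality almost everywhere in the triangle inequality, so one of the two is that Dirac mass. Hence
`Φ` permutes Dirac masses and induces an isometry `ψ`.

Atoms are metric data too. Given `x ≠ y`, collapse everything except `y` onto `x`. The image lies
between `μ` and the Dirac mass at `x`, and this relation forces `μ` to have at least as much mass at
`y` (`le_measure_singleton_of_transportCost_add_le`). Measures on `{x, y}` are determined by their
distances to the two Dirac masses, so applying `Φ` gives `μ {y} ≤ Φ μ {ψ y}`. When `μ` is carried by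
a countable set, this domination between probability measures is equality; density of such `μ`
finishes the proof. -/

theorem StrictTriangleInequality.eq_or_eq {X : Type*} [MetricSpace X] (hX : StrictTriangleInequality X)
    {x y z : X} (h : edist x y = edist x z + edist z y) : z = x ∨ z = y := by
  by_contra! hne
  refine (hX x y z hne.1 hne.2).ne ?_
  rw [dist_edist, h, ENNReal.toReal_add (edist_ne_top _ _) (edist_ne_top _ _), ← dist_edist,
    ← dist_edist]

/-! ### Marginals of couplings -/

section Couplings

variable {X : Type*} [MeasurableSpace X]

theorem lintegral_fst_of_mem_couplings {μ ν : Measure X} {π : Measure (X × X)}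
    (hπ : π ∈ couplings μ ν) {f : X → ℝ≥0∞} (hf : Measurable f) :
    ∫⁻ z, f z.1 ∂π = ∫⁻ x, f x ∂μ := by
  rw [← hπ.1, lintegral_map hf measurable_fst]

theorem measure_fst_of_mem_couplings {μ ν : Measure X} {π : Measure (X × X)}
    (hπ : π ∈ couplings μ ν) {s : Set X} (hs : MeasurableSet s) :
    π {z | z.1 ∈ s} = μ s := by
  rw [← hπ.1, Measure.map_apply measurable_fst hs]; rfl

theorem measure_snd_of_mem_couplings {μ ν : Measure X} {π : Measure (X × X)}
    (hπ : π ∈ couplings μ ν) {s : Set X} (hs : MeasurableSet s) :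
    π {z | z.2 ∈ s} = ν s := by
  rw [← hπ.2, Measure.map_apply measurable_snd hs]; rfl

theorem ae_snd_of_mem_couplings {μ ν : Measure X} {π : Measure (X × X)}
    (hπ : π ∈ couplings μ ν) {p : X → Prop} (hp : ∀ᵐ x ∂ν, p x) : ∀ᵐ z ∂π, p z.2 := by
  rw [← hπ.2] at hp
  exact ae_of_ae_map measurable_snd.aemeasurable hp

theorem eq_dirac_of_measure_compl_singleton {μ : Measure X} [IsProbabilityMeasure μ] {x : X}
    (h : μ {x}ᶜ = 0) : μ = Measure.dirac x := by
  have hx : ∀ᵐ y ∂μ, y = x := h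
  calc μ = μ.map id := Measure.map_id.symm
    _ = μ.map fun _ => x := Measure.map_congr hx
    _ = Measure.dirac x := by simp [Measure.map_const]

end Couplings

/-! ### Transport cost: explicit bounds and separation of measures -/

section TransportCost

variable {X : Type*} [MetricSpace X] [MeasurableSpace X]

theorem transportCost_le_of_mem_couplings {μ ν : Measure X} {π : Measure (X × X)}
    (hπ : π ∈ couplings μ ν) : transportCost μ ν ≤ ∫⁻ z, edist z.1 z.2 ∂π :=
  iInf₂_le π hπ

theorem exists_mem_couplings_lintegral_lt {μ ν : Measure X} {c : ℝ≥0∞}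
    (h : transportCost μ ν < c) : ∃ π ∈ couplings μ ν, ∫⁻ z, edist z.1 z.2 ∂π < c := by
  simpa only [transportCost, iInf_lt_iff, exists_prop] using h

theorem transportCost_le_lintegral_prod (μ ν : Measure X) [IsProbabilityMeasure μ]
    [IsProbabilityMeasure ν] :
    transportCost μ ν ≤ ∫⁻ z, edist z.1 z.2 ∂(μ.prod ν) :=
  transportCost_le_of_mem_couplings
    ⟨by simp [Measure.map_fst_prod], by simp [Measure.map_snd_prod]⟩

variable [SecondCountableTopology X] [BorelSpace X]

theorem transportCost_comm (μ ν : Measure X) : transportCost μ ν = transportCost ν μ := by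
  have key (μ ν : Measure X) : transportCost μ ν ≤ transportCost ν μ := by
    refine le_iInf₂ fun π hπ => ?_
    have hmem : π.map Prod.swap ∈ couplings μ ν := by
      constructor
      · rw [Measure.map_map measurable_fst measurable_swap]; exact hπ.2
      · rw [Measure.map_map measurable_snd measurable_swap]; exact hπ.1
    refine (transportCost_le_of_mem_couplings hmem).trans_eq ?_
    rw [lintegral_map (by fun_prop) measurable_swap]
    simp only [Prod.fst_swap, Prod.snd_swap, edist_comm]
  exact (key μ ν).antisymm (key ν μ)

theorem transportCost_map_map_le (μ : Measure X) {f g : X → X} (hf : Measurable f)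
    (hg : Measurable g) :
    transportCost (μ.map f) (μ.map g) ≤ ∫⁻ x, edist (f x) (g x) ∂μ := by
  have hmem : μ.map (fun x => (f x, g x)) ∈ couplings (μ.map f) (μ.map g) := by
    constructor
    · rw [Measure.map_map measurable_fst (hf.prodMk hg)]; rfl
    · rw [Measure.map_map measurable_snd (hf.prodMk hg)]; rfl
  refine (transportCost_le_of_mem_couplings hmem).trans_eq ?_
  rw [lintegral_map (by fun_prop) (hf.prodMk hg)]

theorem transportCost_map_le (μ : Measure X) {g : X → X} (hg : Measurable g) :
    transportCost μ (μ.map g) ≤ ∫⁻ x, edist x (g x) ∂μ := by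
  simpa using transportCost_map_map_le μ measurable_id hg

theorem transportCost_dirac_right (μ : Measure X) [IsProbabilityMeasure μ] (x : X) :
    transportCost μ (Measure.dirac x) = ∫⁻ y, edist y x ∂μ := by
  apply le_antisymm
  · simpa [Measure.map_const] using transportCost_map_le μ (measurable_const (a := x))
  · refine le_iInf₂ fun π hπ => ?_
    rw [← lintegral_fst_of_mem_couplings hπ (f := fun y => edist y x) (by fun_prop)]
    have hx : ∀ᵐ y ∂(Measure.dirac x), y = x := by simp [ae_dirac_eq]
    refine (lintegral_congr_ae ?_).le
    filter_upwards [ae_snd_of_mem_couplings hπ hx] with z hz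
    rw [hz]

theorem transportCost_dirac_left (μ : Measure X) [IsProbabilityMeasure μ] (x : X) :
    transportCost (Measure.dirac x) μ = ∫⁻ y, edist y x ∂μ := by
  rw [transportCost_comm, transportCost_dirac_right]

theorem lintegral_edist_add_edist_prod (μ ν : Measure X) [IsProbabilityMeasure μ]
    [IsProbabilityMeasure ν] (x : X) :
    ∫⁻ z, (edist z.1 x + edist z.2 x) ∂(μ.prod ν) =
      ∫⁻ y, edist y x ∂μ + ∫⁻ y, edist y x ∂ν := by
  rw [lintegral_add_left (by fun_prop)]
  congr 1
  · rw [lintegral_prod _ (by fun_prop)]; simp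
  · rw [lintegral_prod _ (by fun_prop)]; simp

/-- The fraction `a` stays put on the diagonal, and only the fraction `b` is transported. -/
theorem transportCost_convex_combination_le {a b : ℝ≥0∞} (hab : a + b = 1) (μ ν : Measure X) :
    transportCost μ (a • μ + b • ν) ≤ b * transportCost μ ν := by
  have hb : b ≠ ∞ := ne_top_of_le_ne_top ENNReal.one_ne_top (hab ▸ le_add_self)
  rcases eq_or_ne b 0 with rfl | hb0
  · obtain rfl : a = 1 := by simpa using hab
    simpa using transportCost_map_le μ measurable_id
  have hinf : b * transportCost μ ν = ⨅ π ∈ couplings μ ν, b * ∫⁻ z, edist z.1 z.2 ∂π := by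
    simp only [transportCost, ENNReal.mul_iInf_of_ne hb0 hb]
  rw [hinf]
  refine le_iInf₂ fun π hπ => ?_
  have hdiag : Measurable fun x : X => (x, x) := measurable_id.prodMk measurable_id
  have hmem : a • μ.map (fun x => (x, x)) + b • π ∈ couplings μ (a • μ + b • ν) := by
    constructor
    · rw [Measure.map_add _ _ measurable_fst, Measure.map_smul, Measure.map_smul, hπ.1,
        Measure.map_map measurable_fst hdiag]
      change a • μ.map id + _ = _
      rw [Measure.map_id, ← add_smul, hab, one_smul]
    · rw [Measure.map_add _ _ measurable_snd, Measure.map_smul, Measure.map_smul, hπ.2,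
        Measure.map_map measurable_snd hdiag]
      change a • μ.map id + _ = _
      rw [Measure.map_id]
  refine (transportCost_le_of_mem_couplings hmem).trans_eq ?_
  rw [lintegral_add_measure, lintegral_smul_measure, lintegral_smul_measure,
    lintegral_map (by fun_prop) hdiag]
  simp

/-- By Markov, a coupling of cost below `ε * ε` moves mass at most `ε` by a distance `ε` or more. -/
theorem levyProkhorovEDist_le_of_transportCost_le {μ ν : Measure X} {δ : ℝ≥0∞}
    (h : transportCost μ ν ≤ δ * δ) : levyProkhorovEDist μ ν ≤ δ := by
  have key (μ ν : Measure X) (ε : ℝ≥0∞) (B : Set X) (hε : ε < ∞) (hB : MeasurableSet B)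
      (h : transportCost μ ν < ε * ε) : μ B ≤ ν (Metric.thickening ε.toReal B) + ε := by
    have hε0 : ε ≠ 0 := by rintro rfl; simp at h
    obtain ⟨π, hπ, hlt⟩ := exists_mem_couplings_lintegral_lt h
    rw [← measure_fst_of_mem_couplings hπ hB,
      ← measure_snd_of_mem_couplings hπ Metric.isOpen_thickening.measurableSet]
    have hsub : {z : X × X | z.1 ∈ B} ⊆
        {z | z.2 ∈ Metric.thickening ε.toReal B} ∪ {z | ε ≤ edist z.1 z.2} := by
      intro z hz
      by_cases hd : ε ≤ edist z.1 z.2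
      · exact Or.inr hd
      · refine Or.inl (Metric.mem_thickening_iff.2 ⟨z.1, hz, ?_⟩)
        rw [dist_comm, dist_edist]
        exact (ENNReal.toReal_lt_toReal (edist_ne_top _ _) hε.ne).2 (not_le.1 hd)
    refine (measure_mono hsub).trans ((measure_union_le _ _).trans ?_)
    gcongr
    refine (ENNReal.mul_le_mul_iff_right hε0 hε.ne).1 ?_
    exact (mul_meas_ge_le_lintegral₀ (by fun_prop) ε).trans hlt.le
  refine levyProkhorovEDist_le_of_forall μ ν δ fun ε B hδε hε hB => ?_
  have hlt : transportCost μ ν < ε * ε := h.trans_lt (ENNReal.mul_lt_mul hδε hδε)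
  exact ⟨key μ ν ε B hε hB hlt, key ν μ ε B hε hB (transportCost_comm μ ν ▸ hlt)⟩

/-- Passing to the Lévy–Prokhorov distance supplies the triangle inequality without gluing
couplings. -/
theorem eq_of_forall_exists_transportCost_le {μ ν : Measure X} [IsProbabilityMeasure μ]
    [IsProbabilityMeasure ν]
    (h : ∀ ε : ℝ≥0∞, ε ≠ 0 → ∃ κ : Measure X, transportCost μ κ ≤ ε ∧ transportCost κ ν ≤ ε) :
    μ = ν := by
  have h0 : levyProkhorovEDist μ ν = 0 := by
    refine le_antisymm (ENNReal.le_of_forall_pos_le_add fun ε hε _ => ?_) zero_le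
    have hε2 : (ε : ℝ≥0∞) / 2 ≠ 0 := by simpa using hε.ne'
    obtain ⟨κ, h1, h2⟩ := h (ε / 2 * (ε / 2)) (mul_ne_zero hε2 hε2)
    calc levyProkhorovEDist μ ν ≤ levyProkhorovEDist μ κ + levyProkhorovEDist κ ν :=
          levyProkhorovEDist_triangle _ _ _
      _ ≤ ε / 2 + ε / 2 := add_le_add (levyProkhorovEDist_le_of_transportCost_le h1)
          (levyProkhorovEDist_le_of_transportCost_le h2)
      _ = 0 + ε := by rw [ENNReal.add_halves, zero_add]
  refine ext_of_generate_finite _ (BorelSpace.measurable_eq.trans borel_eq_generateFrom_isClosed)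
    isPiSystem_isClosed (fun A hA => ?_) (by simp)
  exact measure_eq_measure_of_levyProkhorovEDist_eq_zero_of_isClosed h0 hA
    ⟨1, Real.zero_lt_one, measure_ne_top _ _⟩ ⟨1, Real.zero_lt_one, measure_ne_top _ _⟩

end TransportCost

/-! ### Betweenness and Dirac masses -/

section Dirac

variable {X : Type*} [MetricSpace X] [MeasurableSpace X] [SecondCountableTopology X] [BorelSpace X]

theorem exists_measurableSet_measure_ne_of_ne_dirac {μ : Measure X} [IsProbabilityMeasure μ]
    (h : ∀ x, μ ≠ Measure.dirac x) : ∃ A, MeasurableSet A ∧ μ A ≠ 0 ∧ μ Aᶜ ≠ 0 := by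
  -- A support point `x`: under a zero-one law every ball around it has null complement.
  obtain ⟨x, -, hx⟩ := exists_mem_forall_mem_nhdsWithin_pos_measure
    (μ := μ.toOuterMeasure) (s := Set.univ) (by simp)
  rw [nhdsWithin_univ] at hx
  by_contra! hA
  refine h x (eq_dirac_of_measure_compl_singleton ?_)
  have hU : ({x}ᶜ : Set X) = ⋃ n : ℕ, (Metric.ball x (1 / (n + 1)))ᶜ := by
    ext y
    simp only [Set.mem_compl_iff, Set.mem_singleton_iff, Set.mem_iUnion, Metric.mem_ball, not_lt]
    constructor
    · intro hy
      obtain ⟨n, hn⟩ := exists_nat_one_div_lt (dist_pos.2 hy)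
      exact ⟨n, hn.le⟩
    · rintro ⟨n, hn⟩ rfl
      rw [dist_self] at hn
      exact absurd hn (not_le.2 Nat.one_div_pos_of_nat)
  rw [hU, measure_iUnion_null_iff]
  intro n
  exact hA _ Metric.isOpen_ball.measurableSet
    (hx _ (Metric.ball_mem_nhds x Nat.one_div_pos_of_nat)).ne'

/-- The product coupling costs at most the left side, so equality `ρ(y,z) = ρ(y,x) + ρ(x,z)` holds
almost everywhere. Strictness makes `{x}ᶜ ×ˢ {x}ᶜ` null, hence one factor is null. -/
theorem eq_dirac_or_eq_dirac_of_add_le (hX : StrictTriangleInequality X) {α β : Measure X}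
    [IsProbabilityMeasure α] [IsProbabilityMeasure β] {x : X} (hα : ∫⁻ y, edist y x ∂α ≠ ∞)
    (hβ : ∫⁻ y, edist y x ∂β ≠ ∞)
    (h : ∫⁻ y, edist y x ∂α + ∫⁻ y, edist y x ∂β ≤ transportCost α β) :
    α = Measure.dirac x ∨ β = Measure.dirac x := by
  have htri (z : X × X) : edist z.1 z.2 ≤ edist z.1 x + edist z.2 x := by
    simpa only [edist_comm x] using edist_triangle z.1 x z.2
  rw [← lintegral_edist_add_edist_prod] at h
  have hle := h.trans (transportCost_le_lintegral_prod α β)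
  have hfin : ∫⁻ z, edist z.1 z.2 ∂(α.prod β) ≠ ∞ := by
    refine ne_top_of_le_ne_top ?_ (lintegral_mono htri)
    rw [lintegral_edist_add_edist_prod]
    exact ENNReal.add_ne_top.2 ⟨hα, hβ⟩
  have hae := ae_eq_of_ae_le_of_lintegral_le (Eventually.of_forall htri) hfin (by fun_prop) hle
  have hnull : (α.prod β) ({x}ᶜ ×ˢ {x}ᶜ) = 0 := by
    refine measure_mono_null (t := {z | ¬edist z.1 z.2 = edist z.1 x + edist z.2 x})
      (fun z hz hz' => ?_) hae
    have hz'' : edist z.1 z.2 = edist z.1 x + edist x z.2 := by rw [edist_comm x]; exact hz'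
    rcases hX.eq_or_eq hz'' with h | h
    · exact hz.1 h.symm
    · exact hz.2 h.symm
  rw [Measure.prod_prod, mul_eq_zero] at hnull
  exact hnull.imp eq_dirac_of_measure_compl_singleton eq_dirac_of_measure_compl_singleton

end Dirac

/-! ### Two-point measures, atoms and countable approximation -/

section Atoms

variable {X : Type*} [MetricSpace X] [MeasurableSpace X] [SecondCountableTopology X] [BorelSpace X]

theorem ae_eq_or_eq_of_lintegral_edist_add_le (hX : StrictTriangleInequality X) {η : Measure X}
    [IsProbabilityMeasure η] {x y : X}
    (h : ∫⁻ z, edist z x ∂η + ∫⁻ z, edist z y ∂η ≤ edist x y) : ∀ᵐ z ∂η, z = x ∨ z = y := by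
  rw [← lintegral_add_left (by fun_prop)] at h
  have htri (z : X) : edist x y ≤ edist z x + edist z y := by
    simpa only [edist_comm x z] using edist_triangle x z y
  have hae := ae_eq_of_ae_le_of_lintegral_le (μ := η) (f := fun _ => edist x y)
    (Eventually.of_forall htri) (by simp [edist_ne_top]) (by fun_prop) (by simpa using h)
  filter_upwards [hae] with z hz
  exact hX.eq_or_eq (by simpa only [edist_comm x z] using hz)

theorem lintegral_edist_of_ae_eq_or_eq {η : Measure X} {x y : X}
    (h : ∀ᵐ z ∂η, z = x ∨ z = y) : ∫⁻ z, edist z x ∂η = η {y} * edist y x := by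
  have hcongr : (fun z => edist z x) =ᵐ[η] ({y} : Set X).indicator fun _ => edist y x := by
    filter_upwards [h] with z hz
    by_cases hzy : z = y
    · simp [hzy]
    · rw [Set.indicator_of_notMem (by simpa using hzy), hz.resolve_right hzy, edist_self]
  rw [lintegral_congr_ae hcongr, lintegral_indicator_const (measurableSet_singleton y), mul_comm]

/-- The excess `g` of the detour through `y` on the way to `x` vanishes only at `y`. For a coupling
of `μ` and `η`, the hypothesis bounds the integral of `g` over the mass arriving at `y` by the
deviation from optimality. By Markov that mass comes almost entirely from `{g < δ}`; then `δ`
shrinks to zero. No optimal coupling is needed. -/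
theorem le_measure_singleton_of_transportCost_add_le (hX : StrictTriangleInequality X)
    {μ η : Measure X} [IsProbabilityMeasure μ] {x y : X} (hxy : x ≠ y)
    (hη : ∀ᵐ z ∂η, z = x ∨ z = y) (hμ : ∫⁻ z, edist z x ∂μ ≠ ∞)
    (h : transportCost μ η + η {y} * edist y x ≤ ∫⁻ z, edist z x ∂μ) : η {y} ≤ μ {y} := by
  set g : X → ℝ≥0∞ := fun z => edist z y + edist y x - edist z x
  have hgm : Measurable g := by fun_prop
  have hadd (z : X) : edist z x + g z = edist z y + edist y x :=
    add_tsub_cancel_of_le (edist_triangle z y x)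
  have hg0 (z : X) (hz : g z = 0) : z = y := by
    have h1 := hadd z
    rw [hz, add_zero] at h1
    exact ((hX.eq_or_eq h1).resolve_right hxy.symm).symm
  have hY : MeasurableSet {z : X × X | z.2 = y} := measurable_snd (measurableSet_singleton y)
  have hcost (ε : ℝ≥0∞) (hε : ε ≠ 0) : ∃ π ∈ couplings μ η,
      ∫⁻ z, {z : X × X | z.2 = y}.indicator (fun z => g z.1) z ∂π ≤ ε := by
    have hfin : transportCost μ η ≠ ∞ := ne_top_of_le_ne_top hμ (le_self_add.trans h)
    obtain ⟨π, hπ, hlt⟩ := exists_mem_couplings_lintegral_lt (ENNReal.lt_add_right hfin hε)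
    refine ⟨π, hπ, ?_⟩
    have hsum : ∫⁻ z, edist z.1 z.2 ∂π + η {y} * edist y x = ∫⁻ z, edist z x ∂μ +
        ∫⁻ z, {z : X × X | z.2 = y}.indicator (fun z => g z.1) z ∂π := by
      rw [← lintegral_fst_of_mem_couplings hπ (f := fun z => edist z x) (by fun_prop),
        ← measure_snd_of_mem_couplings hπ (measurableSet_singleton y), mul_comm]
      simp only [Set.mem_singleton_iff]
      rw [← lintegral_indicator_const hY, ← lintegral_add_left (by fun_prop),
        ← lintegral_add_left (by fun_prop)]
      refine lintegral_congr_ae ?_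
      filter_upwards [ae_snd_of_mem_couplings hπ hη] with z hz
      by_cases hzy : z.2 = y
      · simp [hzy, hadd]
      · rw [Set.indicator_of_notMem (by simpa using hzy), Set.indicator_of_notMem
          (by simpa using hzy), hz.resolve_right hzy]
    refine (ENNReal.add_le_add_iff_left hμ).1 (hsum.symm.le.trans ?_)
    calc ∫⁻ z, edist z.1 z.2 ∂π + η {y} * edist y x
        ≤ transportCost μ η + ε + η {y} * edist y x := by gcongr
      _ = transportCost μ η + η {y} * edist y x + ε := by ring
      _ ≤ _ := by gcongr
  have hδ (δ : ℝ≥0∞) (hδ0 : δ ≠ 0) (hδt : δ ≠ ∞) : η {y} ≤ μ (g ⁻¹' Set.Iio δ) := by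
    refine ENNReal.le_of_forall_pos_le_add fun ε hε _ => ?_
    obtain ⟨π, hπ, hle⟩ := hcost (δ * ε) (mul_ne_zero hδ0 (by simpa using hε.ne'))
    rw [← measure_fst_of_mem_couplings hπ (hgm measurableSet_Iio),
      ← measure_snd_of_mem_couplings hπ (measurableSet_singleton y)]
    have hsub : {z : X × X | z.2 ∈ ({y} : Set X)} ⊆ {z | z.1 ∈ g ⁻¹' Set.Iio δ} ∪
        {z | δ ≤ {z : X × X | z.2 = y}.indicator (fun z => g z.1) z} := by
      intro z hz
      by_cases hd : g z.1 < δ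
      · exact Or.inl hd
      · right
        have hz2 : z.2 = y := hz
        simpa [hz2] using hd
    refine (measure_mono hsub).trans ((measure_union_le _ _).trans ?_)
    gcongr
    refine (ENNReal.mul_le_mul_iff_right hδ0 hδt).1 (le_trans ?_ hle)
    exact mul_meas_ge_le_lintegral₀ ((hgm.comp measurable_fst).indicator hY).aemeasurable δ
  have hInter : (⋂ n : ℕ, {z | g z < (n + 1 : ℝ≥0∞)⁻¹}) ⊆ {y} := by
    intro z hz
    refine hg0 z (by_contra fun hne => ?_)
    obtain ⟨n, hn⟩ := ENNReal.exists_inv_nat_lt hne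
    have h1 : g z < (n + 1 : ℝ≥0∞)⁻¹ := Set.mem_iInter.1 hz n
    refine lt_irrefl _ ((hn.trans h1).trans_le (ENNReal.inv_le_inv.2 le_self_add))
  have hanti : Antitone fun n : ℕ => {z | g z < (n + 1 : ℝ≥0∞)⁻¹} := fun m n hmn z hz =>
    lt_of_lt_of_le hz (ENNReal.inv_le_inv.2 (by gcongr))
  have hlim := tendsto_measure_iInter_atTop (μ := μ)
    (fun n => (hgm measurableSet_Iio).nullMeasurableSet) hanti ⟨0, measure_ne_top _ _⟩
  refine (ge_of_tendsto' hlim fun n => hδ _ ?_ ?_).trans (measure_mono hInter)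
  · simp
  · simp

/-- The collapse fixes `y`, so compared with moving everything to `x` it saves exactly the cost of
the atom at `y`. -/
theorem transportCost_map_ite_add_le (μ : Measure X) (x y : X) [DecidableEq X] :
    transportCost μ (μ.map fun z => if z = y then y else x) + μ {y} * edist y x ≤
      ∫⁻ z, edist z x ∂μ := by
  have hm : Measurable fun z : X => if z = y then y else x :=
    Measurable.ite (measurableSet_singleton y) measurable_const measurable_const
  refine (add_le_add_left (transportCost_map_le μ hm) _).trans_eq ?_
  rw [mul_comm, ← lintegral_indicator_const (measurableSet_singleton y),
    ← lintegral_add_left (by fun_prop)]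
  congr 1 with z
  by_cases hz : z = y <;> simp [hz]

theorem measure_le_of_forall_singleton_le {μ ν : Measure X} {S : Set X} (hS : S.Countable)
    (hμ : μ Sᶜ = 0) (h : ∀ y, μ {y} ≤ ν {y}) : μ ≤ ν := by
  refine Measure.le_intro fun s _ _ => ?_
  have hc : (s ∩ S).Countable := hS.mono Set.inter_subset_right
  have hsum (κ : Measure X) : κ (s ∩ S) = ∑' y : ↥(s ∩ S), κ {(y : X)} := by
    rw [← measure_biUnion hc (fun a _ b _ hab => Set.disjoint_singleton.2 hab)
      (fun y _ => measurableSet_singleton y), Set.biUnion_of_singleton]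
  calc μ s ≤ μ ((s ∩ S) ∪ Sᶜ) := measure_mono fun z hz => by
        by_cases hzS : z ∈ S
        · exact Or.inl ⟨hz, hzS⟩
        · exact Or.inr hzS
    _ ≤ μ (s ∩ S) + μ Sᶜ := measure_union_le _ _
    _ = ∑' y : ↥(s ∩ S), μ {(y : X)} := by rw [hμ, add_zero, hsum]
    _ ≤ ∑' y : ↥(s ∩ S), ν {(y : X)} := ENNReal.tsum_le_tsum fun y => h y
    _ = ν (s ∩ S) := (hsum ν).symm
    _ ≤ ν s := measure_mono Set.inter_subset_left

theorem exists_measurable_countable_range_edist_le {ε : ℝ≥0∞} (hε : ε ≠ 0) :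
    ∃ f : X → X, Measurable f ∧ (Set.range f).Countable ∧ ∀ x, edist (f x) x ≤ ε := by
  classical
  rcases isEmpty_or_nonempty X with hX | hX
  · exact ⟨id, measurable_id, Set.countable_range id, fun x => hX.elim x⟩
  have hex (x : X) : ∃ n, edist (TopologicalSpace.denseSeq X n) x < ε := by
    obtain ⟨_, ⟨n, rfl⟩, hn⟩ := EMetric.mem_closure_iff.1
      (TopologicalSpace.denseRange_denseSeq X x) ε (pos_iff_ne_zero.2 hε)
    exact ⟨n, edist_comm x _ ▸ hn⟩
  refine ⟨fun x => TopologicalSpace.denseSeq X (Nat.find (hex x)), ?_, ?_, fun x =>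
    (Nat.find_spec (hex x)).le⟩
  · exact (measurable_from_nat (f := TopologicalSpace.denseSeq X)).comp
      (measurable_find hex fun n => measurableSet_lt (by fun_prop) measurable_const)
  · exact (Set.countable_range (TopologicalSpace.denseSeq X)).mono
      (Set.range_comp_subset_range _ (TopologicalSpace.denseSeq X))

end Atoms

/-! ### Dirac masses and atoms under an isometry -/

namespace WassersteinOne

variable {X : Type*} [MetricSpace X] [MeasurableSpace X]

instance (μ : WassersteinOne X) : IsProbabilityMeasure μ.toMeasure := μ.2.1

theorem toMeasure_injective : Function.Injective (toMeasure (X := X)) := Subtype.val_injective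

/-- The conditioning of a point of the Wasserstein space on a set of positive measure. -/
noncomputable def cond (μ : WassersteinOne X) (A : Set X) (hA : μ.toMeasure A ≠ 0) :
    WassersteinOne X :=
  ⟨μ.toMeasure[|A], cond_isProbabilityMeasure hA, μ.2.2.choose, by
    rw [ProbabilityTheory.cond, lintegral_smul_measure]
    exact ENNReal.mul_lt_top (ENNReal.inv_lt_top.2 (pos_iff_ne_zero.2 hA))
      ((setLIntegral_le_lintegral _ _).trans_lt μ.2.2.choose_spec)⟩

theorem toMeasure_cond (μ : WassersteinOne X) (A : Set X) (hA : μ.toMeasure A ≠ 0) :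
    (μ.cond A hA).toMeasure = μ.toMeasure[|A] := rfl

variable [BorelSpace X]

theorem lintegral_edist_ne_top (μ : WassersteinOne X) (x : X) :
    ∫⁻ y, edist y x ∂μ.toMeasure ≠ ∞ := by
  obtain ⟨x₀, h⟩ := μ.2.2
  refine ne_top_of_le_ne_top ?_ (lintegral_mono fun y => edist_triangle y x₀ x)
  rw [lintegral_add_left (by fun_prop)]
  exact ENNReal.add_ne_top.2 ⟨h.ne, by simp [edist_ne_top]⟩

variable [SecondCountableTopology X]

theorem transportCost_ne_top (μ ν : WassersteinOne X) :
    transportCost μ.toMeasure ν.toMeasure ≠ ∞ := by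
  obtain ⟨x, -⟩ := μ.2.2
  refine ne_top_of_le_ne_top ?_ ((transportCost_le_lintegral_prod _ _).trans
    (lintegral_mono fun z => (edist_triangle z.1 x z.2).trans_eq (by rw [edist_comm x])))
  rw [lintegral_edist_add_edist_prod]
  exact ENNReal.add_ne_top.2 ⟨μ.lintegral_edist_ne_top x, ν.lintegral_edist_ne_top x⟩

theorem transportCost_eq_of_dist_eq {μ ν μ' ν' : WassersteinOne X} (h : dist μ ν = dist μ' ν') :
    transportCost μ.toMeasure ν.toMeasure = transportCost μ'.toMeasure ν'.toMeasure :=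
  (ENNReal.toReal_eq_toReal_iff' (transportCost_ne_top _ _) (transportCost_ne_top _ _)).1 h

/-- The Dirac measure at `x`, as a point of the Wasserstein space. -/
noncomputable def dirac (x : X) : WassersteinOne X :=
  ⟨Measure.dirac x, inferInstance, x, by simp⟩

@[simp]
theorem toMeasure_dirac (x : X) : (dirac x).toMeasure = Measure.dirac x := rfl

theorem dirac_injective : Function.Injective (dirac (X := X)) := fun x y h => by
  have h1 : transportCost (dirac x).toMeasure (dirac y).toMeasure = edist x y := by
    simp [transportCost_dirac_right]
  rw [h, toMeasure_dirac, transportCost_dirac_right] at h1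
  simpa using h1.symm

/-- The pushforward of a point of the Wasserstein space along a measurable map, provided that the
image has finite first moment. -/
noncomputable def map (μ : WassersteinOne X) (f : X → X) (hf : Measurable f) (x : X)
    (h : ∫⁻ y, edist (f y) x ∂μ.toMeasure < ∞) : WassersteinOne X :=
  ⟨μ.toMeasure.map f, Measure.isProbabilityMeasure_map hf.aemeasurable, x, by
    rwa [lintegral_map (by fun_prop) hf]⟩

/-- `μ` does not lie strictly between two points of the Wasserstein space. -/
def IsEndpoint (μ : WassersteinOne X) : Prop :=
  ∀ α β : WassersteinOne X, transportCost α.toMeasure μ.toMeasure +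
    transportCost μ.toMeasure β.toMeasure ≤ transportCost α.toMeasure β.toMeasure →
      α = μ ∨ β = μ

theorem isEndpoint_dirac (hX : StrictTriangleInequality X) (x : X) : IsEndpoint (dirac x) := by
  intro α β h
  rw [toMeasure_dirac, transportCost_dirac_left, transportCost_dirac_right] at h
  exact (eq_dirac_or_eq_dirac_of_add_le hX (α.lintegral_edist_ne_top x)
    (β.lintegral_edist_ne_top x) h).imp (fun h => toMeasure_injective h)
      (fun h => toMeasure_injective h)

/-- Reaching `μ` from its conditional on `A` costs at most `μ Aᶜ` times the cost between the two
conditionals, and from the other one `μ A` times it. These weights sum to one. -/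
theorem IsEndpoint.exists_eq_dirac {μ : WassersteinOne X} (hμ : IsEndpoint μ) :
    ∃ x, μ = dirac x := by
  by_contra! hne
  obtain ⟨A, hA, hA0, hA1⟩ := exists_measurableSet_measure_ne_of_ne_dirac (μ := μ.toMeasure)
    fun x h => hne x (toMeasure_injective h)
  have hsum : μ.toMeasure A + μ.toMeasure Aᶜ = 1 := by rw [measure_add_measure_compl hA]; simp
  have hsmul (B : Set X) (hB : μ.toMeasure B ≠ 0) :
      μ.toMeasure B • (μ.cond B hB).toMeasure = μ.toMeasure.restrict B := by
    rw [toMeasure_cond, ProbabilityTheory.cond, smul_smul,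
      ENNReal.mul_inv_cancel hB (measure_ne_top _ _), one_smul]
  have hμeq : μ.toMeasure A • (μ.cond A hA0).toMeasure +
      μ.toMeasure Aᶜ • (μ.cond Aᶜ hA1).toMeasure = μ.toMeasure := by
    rw [hsmul, hsmul, Measure.restrict_add_restrict_compl hA]
  have h1 := transportCost_convex_combination_le hsum (μ.cond A hA0).toMeasure
    (μ.cond Aᶜ hA1).toMeasure
  have h2 := transportCost_convex_combination_le ((add_comm _ _).trans hsum)
    (μ.cond Aᶜ hA1).toMeasure (μ.cond A hA0).toMeasure
  rw [hμeq] at h1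
  rw [add_comm, hμeq, transportCost_comm, transportCost_comm (μ.cond Aᶜ hA1).toMeasure] at h2
  have hself (B : Set X) (hB : MeasurableSet B) (hB0 : μ.toMeasure B ≠ 0)
      (hB1 : μ.toMeasure Bᶜ ≠ 0) : μ.cond B hB0 ≠ μ := by
    intro h
    have h' := congrArg (fun ν => ν.toMeasure Bᶜ) h
    simp only [toMeasure_cond, cond_apply hB, Set.inter_compl_self, measure_empty, mul_zero] at h'
    exact hB1 h'.symm
  rcases hμ _ _ ((add_le_add h1 h2).trans_eq (by rw [← add_mul, add_comm, hsum, one_mul]))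
    with h | h
  · exact hself A hA hA0 hA1 h
  · exact hself Aᶜ hA.compl hA1 (by rwa [compl_compl]) h

theorem isEndpoint_iff {Φ : WassersteinOne X → WassersteinOne X} (hΦ : Function.Bijective Φ)
    (hdist : ∀ μ ν, dist (Φ μ) (Φ ν) = dist μ ν) (μ : WassersteinOne X) :
    IsEndpoint (Φ μ) ↔ IsEndpoint μ := by
  have hcost (μ ν : WassersteinOne X) :
      transportCost (Φ μ).toMeasure (Φ ν).toMeasure = transportCost μ.toMeasure ν.toMeasure :=
    transportCost_eq_of_dist_eq (hdist μ ν)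
  refine hΦ.surjective.forall.trans (forall_congr' fun α => ?_)
  refine hΦ.surjective.forall.trans (forall_congr' fun β => ?_)
  rw [hcost, hcost, hcost, hΦ.injective.eq_iff, hΦ.injective.eq_iff]

theorem exists_isometryEquiv_map_dirac (hX : StrictTriangleInequality X)
    {Φ : WassersteinOne X → WassersteinOne X} (hΦ : Function.Bijective Φ)
    (hdist : ∀ μ ν, dist (Φ μ) (Φ ν) = dist μ ν) :
    ∃ ψ : X ≃ᵢ X, ∀ x, Φ (dirac x) = dirac (ψ x) := by
  choose ψ hψ using fun x => ((isEndpoint_iff hΦ hdist _).2 (isEndpoint_dirac hX x)).exists_eq_dirac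
  have hiso : Isometry ψ := fun x y => by
    have h := transportCost_eq_of_dist_eq (hdist (dirac x) (dirac y))
    simpa [hψ, transportCost_dirac_right] using h
  have hsurj : Function.Surjective ψ := fun y => by
    obtain ⟨μ, hμ⟩ := hΦ.surjective (dirac y)
    obtain ⟨x, rfl⟩ := ((isEndpoint_iff hΦ hdist μ).1 (hμ ▸ isEndpoint_dirac hX y)).exists_eq_dirac
    exact ⟨x, dirac_injective ((hψ x).symm.trans hμ)⟩
  exact ⟨⟨Equiv.ofBijective ψ ⟨hiso.injective, hsurj⟩, hiso⟩, hψ⟩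

theorem measure_singleton_le_of_map_dirac (hX : StrictTriangleInequality X)
    {Φ : WassersteinOne X → WassersteinOne X} (hdist : ∀ μ ν, dist (Φ μ) (Φ ν) = dist μ ν)
    {ψ : X ≃ᵢ X} (hψ : ∀ x, Φ (dirac x) = dirac (ψ x)) (μ : WassersteinOne X) (y : X) :
    μ.toMeasure {y} ≤ (Φ μ).toMeasure {ψ y} := by
  classical
  have hmom (ν : WassersteinOne X) (x : X) :
      ∫⁻ z, edist z (ψ x) ∂(Φ ν).toMeasure = ∫⁻ z, edist z x ∂ν.toMeasure := by
    have h := transportCost_eq_of_dist_eq (hdist ν (dirac x))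
    rwa [hψ, toMeasure_dirac, toMeasure_dirac, transportCost_dirac_right,
      transportCost_dirac_right] at h
  -- The collapse needs a second point, so the one-point space is treated apart.
  by_cases hy : ∀ x, x = y
  · have huniv : ({ψ y} : Set X) = Set.univ :=
      Set.eq_univ_of_forall fun z => (hy z).trans (hy _).symm
    rw [huniv, measure_univ]
    exact prob_le_one
  push Not at hy
  obtain ⟨x, hxy⟩ := hy
  have hg : Measurable fun z : X => if z = y then y else x :=
    Measurable.ite (measurableSet_singleton y) measurable_const measurable_const
  have hfin : ∫⁻ z, edist (if z = y then y else x) x ∂μ.toMeasure < ∞ := by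
    refine (lintegral_mono (g := fun _ => edist y x) fun z => ?_).trans_lt
      (by simp [edist_lt_top])
    by_cases hz : z = y <;> simp [hz]
  set η := μ.map _ hg x hfin
  have hηt : η.toMeasure = μ.toMeasure.map fun z => if z = y then y else x := rfl
  have hηy : η.toMeasure {y} = μ.toMeasure {y} := by
    rw [hηt, Measure.map_apply hg (measurableSet_singleton y)]
    congr 1 with z
    by_cases hz : z = y <;> simp [hz, hxy]
  have hηae : ∀ᵐ z ∂η.toMeasure, z = x ∨ z = y := by
    have hset : MeasurableSet {z | z = x ∨ z = y} :=
      (measurableSet_singleton x).union (measurableSet_singleton y)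
    rw [hηt, ae_map_iff hg.aemeasurable hset]
    refine Eventually.of_forall fun z => ?_
    by_cases hz : z = y <;> simp [hz]
  -- Living on `{x, y}` means that the distances to the two Dirac masses sum to `ρ(x,y)`, which `Φ`
  -- preserves.
  have hηae' : ∀ᵐ z ∂(Φ η).toMeasure, z = ψ x ∨ z = ψ y := by
    refine ae_eq_or_eq_of_lintegral_edist_add_le hX ?_
    rw [hmom, hmom, ψ.edist_eq, ← lintegral_add_left (by fun_prop)]
    refine (lintegral_congr_ae (g := fun _ => edist x y) ?_).trans_le (by simp)
    filter_upwards [hηae] with z hz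
    rcases hz with rfl | rfl <;> simp [edist_comm]
  -- The weight at `y` is the distance to the Dirac mass at `x` divided by `ρ(x,y)`.
  have hηψ : (Φ η).toMeasure {ψ y} = μ.toMeasure {y} := by
    have h := hmom η x
    rw [lintegral_edist_of_ae_eq_or_eq hηae, lintegral_edist_of_ae_eq_or_eq hηae', ψ.edist_eq,
      hηy] at h
    exact (ENNReal.mul_left_inj (edist_pos.2 hxy.symm).ne' (edist_ne_top _ _)).1 h
  rw [← hηψ]
  refine le_measure_singleton_of_transportCost_add_le hX (ψ.injective.ne hxy) hηae'
    ((Φ μ).lintegral_edist_ne_top _) ?_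
  rw [hmom, ψ.edist_eq, hηψ, transportCost_eq_of_dist_eq (hdist μ η)]
  exact transportCost_map_ite_add_le μ.toMeasure x y

theorem toMeasure_eq_map_of_countable (hX : StrictTriangleInequality X)
    {Φ : WassersteinOne X → WassersteinOne X} (hdist : ∀ μ ν, dist (Φ μ) (Φ ν) = dist μ ν)
    {ψ : X ≃ᵢ X} (hψ : ∀ x, Φ (dirac x) = dirac (ψ x)) (μ : WassersteinOne X) {S : Set X}
    (hS : S.Countable) (hμ : μ.toMeasure Sᶜ = 0) :
    (Φ μ).toMeasure = μ.toMeasure.map ψ := by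
  have hψm : Measurable ψ := ψ.continuous.measurable
  have := Measure.isProbabilityMeasure_map (μ := μ.toMeasure) hψm.aemeasurable
  refine (Measure.eq_of_le_of_isProbabilityMeasure
    (measure_le_of_forall_singleton_le (hS.image ψ) ?_ fun z => ?_)).symm
  · rw [Measure.map_apply hψm (hS.image ψ).measurableSet.compl, Set.preimage_compl,
      Set.preimage_image_eq _ ψ.injective, hμ]
  · obtain ⟨y, rfl⟩ := ψ.surjective z
    rw [Measure.map_apply hψm (measurableSet_singleton _), ← Set.image_singleton,
      Set.preimage_image_eq _ ψ.injective, Set.image_singleton]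
    exact measure_singleton_le_of_map_dirac hX hdist hψ μ y

end WassersteinOne

theorem mainTheorem4 {X : Type*} [MetricSpace X] [CompleteSpace X]
    [TopologicalSpace.SeparableSpace X] [MeasurableSpace X] [BorelSpace X]
    (hX : StrictTriangleInequality X)
    (Φ : WassersteinOne X → WassersteinOne X) (hΦ_bij : Function.Bijective Φ)
    (hΦ_dist : ∀ μ ν : WassersteinOne X, dist (Φ μ) (Φ ν) = dist μ ν) :
    ∃ ψ : X ≃ᵢ X, ∀ μ : WassersteinOne X, (Φ μ).toMeasure = μ.toMeasure.map ψ := by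
  have : SecondCountableTopology X := UniformSpace.secondCountable_of_separable X
  obtain ⟨ψ, hψ⟩ := WassersteinOne.exists_isometryEquiv_map_dirac hX hΦ_bij hΦ_dist
  refine ⟨ψ, fun μ => ?_⟩
  have hψm : Measurable ψ := ψ.continuous.measurable
  have := Measure.isProbabilityMeasure_map (μ := μ.toMeasure) hψm.aemeasurable
  refine eq_of_forall_exists_transportCost_le fun ε hε => ?_
  -- Since `ε` may be infinite, the cap at `1` keeps the first moment of the discretised measure
  -- finite.
  obtain ⟨f, hf, hcount, hfε⟩ := exists_measurable_countable_range_edist_le (X := X)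
    (ε := min ε 1) (by simpa using hε)
  obtain ⟨x, hx⟩ := μ.2.2
  have hfin : ∫⁻ y, edist (f y) x ∂μ.toMeasure < ∞ := by
    refine (lintegral_mono fun y => (edist_triangle (f y) y x).trans
      (add_le_add_left ((hfε y).trans (min_le_right _ _)) _)).trans_lt ?_
    rw [lintegral_add_left measurable_const]
    exact ENNReal.add_lt_top.2 ⟨by simp, hx⟩
  set κ := μ.map f hf x hfin
  have hκt : κ.toMeasure = μ.toMeasure.map f := rfl
  have hκ : κ.toMeasure (Set.range f)ᶜ = 0 := by
    rw [hκt, Measure.map_apply hf hcount.measurableSet.compl]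
    simp
  have hle : ∫⁻ y, edist (f y) y ∂μ.toMeasure ≤ ε :=
    (lintegral_mono fun y => (hfε y).trans (min_le_left _ _)).trans_eq (by simp)
  refine ⟨(Φ κ).toMeasure, ?_, ?_⟩
  · rw [WassersteinOne.transportCost_eq_of_dist_eq (hΦ_dist μ κ), hκt]
    refine (transportCost_map_le _ hf).trans (le_trans (le_of_eq ?_) hle)
    simp only [edist_comm]
  · rw [WassersteinOne.toMeasure_eq_map_of_countable hX hΦ_dist hψ κ hcount hκ, hκt,
      Measure.map_map hψm hf]
    refine (transportCost_map_map_le _ (hψm.comp hf) hψm).trans (le_trans (le_of_eq ?_) hle)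
    simp only [Function.comp_apply, ψ.edist_eq]
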